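/- Let $d\ge 3$ and let $V$ be a finite-dimensional complex vector space with $N=\dim_{\mathbb C}V\ge 3$. Let $\operatorname{Sym}^dV^*$ be the complex vector space of symmetric $d$-linear forms $F\colon V^d\to\mathbb C$, and let $\operatorname{Sym}^d_oV^*\subset\operatorname{Sym}^dV^*$ be the subset of those $F$ for which the zero locus $Z(F)=\{[v]\in\mathbb PV : F(v,\dots,v)=0\}$ is not a cone (where $Z(F)$ is called a cone if it contains a point $x$ such that for every $y\in Z(F)$ all points of the line joining $x$ and $y$ lie in $Z(F)$; in particular $F=0$ is excluded). Equip $\operatorname{Sym}^d_oV^*$ with the subspace topology of the Zariski topology on $\operatorname{Sym}^dV^*$. For $F\in\operatorname{Sym}^d_oV^*$ let $$\mathfrak g_F=\{g\in\operatorname{End}(V) : F(gv_1,v_2,\dots,v_d)=F(v_1,gv_2,\dots,v_d)=\cdots=F(v_1,\dots,v_{d-1},gv_d)\ \text{ for all } v_1,\dots,v_d\in V\}$$ be the symmetrizer algebra of $F$, which is a commuting space of endomorphisms, and let $\mathfrak g_F^+\subset\mathfrak g_F$ be the linear subspace of all nilpotent elements of $\mathfrak g_F$. Proposition. The function $$\operatorname{Sym}^d_oV^*\to\mathbb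 Z,\qquad F\mapsto\dim_{\mathbb C}\mathfrak g_F^+,$$ is upper semicontinuous in the Zariski topology. -/

import Mathlib

open scoped LinearAlgebra.Projectivization

noncomputable section

/-- The complex vector space `Sym^d V^*` of symmetric `d`-linear forms on `V`. -/
def SymForm (V : Type*) [AddCommGroup V] [Module ℂ V] (d : ℕ) :
    Submodule ℂ (MultilinearMap ℂ (fun _ : Fin d => V) ℂ) where
  carrier := {F | ∀ (σ : Equiv.Perm (Fin d)) (v : Fin d → V), F (fun i => v (σ i)) = F v}
  add_mem' := by
    intro F G hF hG σ v
    change F _ + G _ = F v + G v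
    rw [hF σ v, hG σ v]
  zero_mem' := by
    intro σ v
    simp
  smul_mem' := by
    intro c F hF σ v
    change c • F _ = c • F v
    rw [hF σ v]

/-- The zero locus `Z(F)` in `ℙ V` of the homogeneous polynomial `v ↦ F(v, …, v)`. -/
def hypersurface {V : Type*} [AddCommGroup V] [Module ℂ V] {d : ℕ} (F : SymForm V d) :
    Set (ℙ ℂ V) :=
  {x | F.1 (fun _ => x.rep) = 0}

/-- `Z(F)` is a cone: it has a vertex `x`, that is, a point `x` of `Z(F)` such that for every
point `y` of `Z(F)` all points `z` on the line joining `x` and `y` belong to `Z(F)`. (The form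
`F = 0`, for which `Z(F)` is the whole projective space, counts as a cone.) -/
def IsCone {V : Type*} [AddCommGroup V] [Module ℂ V] {d : ℕ} (F : SymForm V d) : Prop :=
  ∃ x ∈ hypersurface F, ∀ y ∈ hypersurface F, ∀ z : ℙ ℂ V,
    z.submodule ≤ x.submodule ⊔ y.submodule → z ∈ hypersurface F

/-- `Sym^d_o V^*`: the symmetric `d`-forms `F` such that `Z(F)` is not a cone. -/
def SymFormNotCone (V : Type*) [AddCommGroup V] [Module ℂ V] (d : ℕ) : Type _ :=
  {F : SymForm V d // ¬ IsCone F}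

/-- The algebra of polynomial functions on a complex vector space `W`, generated by the linear
forms on `W`. -/
def polyFunctions (W : Type*) [AddCommGroup W] [Module ℂ W] : Subalgebra ℂ (W → ℂ) :=
  Algebra.adjoin ℂ {f | ∃ l : Module.Dual ℂ W, f = fun w => l w}

/-- The Zariski topology on a complex vector space: the closed sets are the sets of common zeros
of arbitrary families of polynomial functions. -/
@[reducible]
def zariskiTopology (W : Type*) [AddCommGroup W] [Module ℂ W] : TopologicalSpace W :=
  TopologicalSpace.ofClosed
    {Z | ∃ S : Set (W → ℂ), S ⊆ (polyFunctions W : Set (W → ℂ)) ∧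
      Z = {w | ∀ f ∈ S, f w = 0}}
    ⟨{1}, by simp, by ext w; simp⟩
    (by
      intro A hA
      refine ⟨{f | f ∈ polyFunctions W ∧ ∃ Z ∈ A, ∀ w ∈ Z, f w = 0},
        fun f hf => hf.1, ?_⟩
      ext w
      constructor
      · rintro hw f ⟨-, Z, hZ, hf⟩
        exact hf w (hw Z hZ)
      · intro hw Z hZ
        obtain ⟨S, hS, rfl⟩ := hA hZ
        intro f hf
        exact hw f ⟨hS hf, _, hZ, fun w' hw' => hw' f hf⟩)
    (by
      rintro _ ⟨S, hS, rfl⟩ _ ⟨T, hT, rfl⟩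
      refine ⟨{h | ∃ f ∈ S, ∃ g ∈ T, h = f * g}, ?_, ?_⟩
      · rintro _ ⟨f, hf, g, hg, rfl⟩
        exact mul_mem (hS hf) (hT hg)
      · ext w
        constructor
        · rintro (hw | hw) _ ⟨f, hf, g, hg, rfl⟩
          · simp [hw f hf]
          · simp [hw g hg]
        · intro hw
          by_contra hcon
          simp only [Set.mem_union, Set.mem_ofPred_eq, not_or, not_forall] at hcon
          obtain ⟨⟨f, hf, hfw⟩, g, hg, hgw⟩ := hcon
          have := hw (f * g) ⟨f, hf, g, hg, rfl⟩
          simp only [Pi.mul_apply, mul_eq_zero] at this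
          exact this.elim hfw hgw)

/-- `Sym^d_o V^*` carries the subspace topology of the Zariski topology on `Sym^d V^*`. -/
instance instTopologicalSpaceSymFormNotCone (V : Type*) [AddCommGroup V] [Module ℂ V] (d : ℕ) :
    TopologicalSpace (SymFormNotCone V d) :=
  (zariskiTopology (SymForm V d)).induced Subtype.val

/-- The symmetrizer algebra `𝔤_F`: all `g` in `End V` for which the forms
`F(v_1, …, g v_i, …, v_d)`, `1 ≤ i ≤ d`, all agree. -/
def symmetrizerAlgebra {V : Type*} [AddCommGroup V] [Module ℂ V] {d : ℕ} (F : SymForm V d) :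
    Submodule ℂ (Module.End ℂ V) where
  carrier := {g | ∀ (i j : Fin d) (v : Fin d → V),
    F.1 (Function.update v i (g (v i))) = F.1 (Function.update v j (g (v j)))}
  add_mem' := by
    intro g h hg hh i j v
    simp only [LinearMap.add_apply, MultilinearMap.map_update_add]
    rw [hg i j v, hh i j v]
  zero_mem' := by
    intro i j v
    simp only [LinearMap.zero_apply, MultilinearMap.map_update_zero]
  smul_mem' := by
    intro c g hg i j v
    simp only [LinearMap.smul_apply, MultilinearMap.map_update_smul]
    rw [hg i j v]

/-- If `Z(F)` is not a cone then `F` is nondegenerate. -/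
theorem eq_zero_of_not_isCone {V : Type*} [AddCommGroup V] [Module ℂ V] {d : ℕ} (hd : 0 < d)
    {F : SymForm V d} (hF : ¬ IsCone F) (u : V)
    (hu : ∀ (i : Fin d) (v : Fin d → V), F.1 (Function.update v i u) = 0) : u = 0 := by
  by_contra hne
  apply hF
  have hu' : ∀ (m : Fin d → V) (i : Fin d) (a : ℂ), m i = a • u → F.1 m = 0 := by
    intro m i a hm
    have h1 : m = Function.update m i (a • u) := by
      rw [← hm, Function.update_eq_self]
    rw [h1, MultilinearMap.map_update_smul, hu, smul_zero]
  have hspan : (Projectivization.mk ℂ u hne).submodule = Submodule.span ℂ {u} :=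
    Projectivization.submodule_mk u hne
  refine ⟨Projectivization.mk ℂ u hne, ?_, ?_⟩
  · have hr : (Projectivization.mk ℂ u hne).rep ∈ Submodule.span ℂ {u} := by
      rw [← hspan, Projectivization.submodule_eq]
      exact Submodule.mem_span_singleton_self _
    obtain ⟨a, ha⟩ := Submodule.mem_span_singleton.1 hr
    exact hu' _ ⟨0, hd⟩ a ha.symm
  · intro y hy z hz
    have hr : z.rep ∈ Submodule.span ℂ {u} ⊔ Submodule.span ℂ {y.rep} := by
      rw [← hspan, ← Projectivization.submodule_eq]
      apply hz
      rw [Projectivization.submodule_eq]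
      exact Submodule.mem_span_singleton_self _
    obtain ⟨p, hp, q, hq, hpq⟩ := Submodule.mem_sup.1 hr
    obtain ⟨a, rfl⟩ := Submodule.mem_span_singleton.1 hp
    obtain ⟨b, rfl⟩ := Submodule.mem_span_singleton.1 hq
    have hexp : (fun _ : Fin d => z.rep) =
        (fun _ : Fin d => a • u) + (fun _ : Fin d => b • y.rep) := by
      funext i
      exact hpq.symm
    change F.1 (fun _ => z.rep) = 0
    rw [hexp, MultilinearMap.map_add_univ]
    refine Finset.sum_eq_zero fun s _ => ?_
    by_cases hs : s.Nonempty
    · obtain ⟨i, hi⟩ := hs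
      exact hu' _ i a (by simp [hi])
    · rw [Finset.not_nonempty_iff_eq_empty] at hs
      subst hs
      have h2 := F.1.map_smul_univ (fun _ : Fin d => b) (fun _ : Fin d => y.rep)
      have h3 : F.1 (fun _ : Fin d => y.rep) = 0 := hy
      rw [h3, smul_zero] at h2
      rw [Finset.piecewise_empty]
      exact h2

/-- If `d ≥ 3` and `Z(F)` is not a cone then the symmetrizers of `F` commute. -/
theorem commute_of_mem_symmetrizerAlgebra {V : Type*} [AddCommGroup V] [Module ℂ V] {d : ℕ}
    (hd : 3 ≤ d) {F : SymForm V d} (hF : ¬ IsCone F) {g h : Module.End ℂ V}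
    (hg : g ∈ symmetrizerAlgebra F) (hh : h ∈ symmetrizerAlgebra F) : Commute g h := by
  have key : ∀ (g h : Module.End ℂ V), g ∈ symmetrizerAlgebra F → h ∈ symmetrizerAlgebra F →
      ∀ (i j k : Fin d), j ≠ i → k ≠ i → k ≠ j → ∀ (v : Fin d → V) (u : V),
      F.1 (Function.update v i (g (h u))) =
        F.1 (Function.update (Function.update (Function.update v i u) j (g (v j)))
          k (h (v k))) := by
    intro g h hg hh i j k hji hki hkj v u
    have h1 := hg i j (Function.update v i (h u))
    have h2 := hh i k (Function.update (Function.update v i u) j (g (v j)))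
    simp only [Function.update_self, Function.update_idem, Function.update_of_ne hji,
      Function.update_of_ne hki, Function.update_of_ne hkj,
      Function.update_of_ne hji.symm] at h1 h2
    rw [h1, ← h2]
    congr 1
    rw [Function.update_comm hji (g (v j)) (h u) (Function.update v i u), Function.update_idem]
  ext u
  have hz : g (h u) - h (g u) = 0 := by
    refine eq_zero_of_not_isCone (by omega) hF _ fun i v => ?_
    obtain ⟨j, hji, -⟩ := Fin.exists_ne_and_ne_of_two_lt i i (by omega)
    obtain ⟨k, hki, hkj⟩ := Fin.exists_ne_and_ne_of_two_lt i j (by omega)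
    rw [MultilinearMap.map_update_sub, key g h hg hh i j k hji hki hkj v u,
      key h g hh hg i k j hki hji hkj.symm v u, Function.update_comm hkj.symm, sub_self]
  exact sub_eq_zero.1 hz

/-- The nilpotent part `𝔤_F^+` of the symmetrizer algebra, for `d ≥ 3` and `F` in `Sym^d_o V^*`:
the subspace of all nilpotent elements of `𝔤_F`. -/
def nilpotentPart {V : Type*} [AddCommGroup V] [Module ℂ V] {d : ℕ} (hd : 3 ≤ d)
    (F : SymFormNotCone V d) : Submodule ℂ (Module.End ℂ V) where
  carrier := {g | g ∈ symmetrizerAlgebra F.1 ∧ IsNilpotent g}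
  add_mem' := by
    rintro g h ⟨hg, hgn⟩ ⟨hh, hhn⟩
    exact ⟨add_mem hg hh,
      (commute_of_mem_symmetrizerAlgebra hd F.2 hg hh).isNilpotent_add hgn hhn⟩
  zero_mem' := ⟨zero_mem _, IsNilpotent.zero⟩
  smul_mem' := by
    rintro c g ⟨hg, hgn⟩
    exact ⟨Submodule.smul_mem _ c hg, hgn.smul c⟩

end

/-!
The function is upper semicontinuous because the nilpotent symmetrizers of a form are cut out by
homogeneous equations, and solvability of such equations is a Zariski closed condition.

Fix a form `F₀` and put `c = dim 𝔤_{F₀}^+`. Choose a linear map `φ : End V → ℂ ^ c` that is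
injective on `𝔤_{F₀}^+` (`Submodule.exists_linearMap_injOn`). If no nonzero nilpotent symmetrizer
of `F` is killed by `φ`, then `φ` is injective on the linear space `𝔤_F^+`, whose dimension is
therefore at most `c`. So it suffices that this condition on `F` holds on a Zariski neighbourhood
of `F₀`.

The endomorphisms to be excluded are the nonzero solutions `g` of the equations expressing that
`g` is a symmetrizer (linear in `g` and in `F`), that `φ g = 0`, and that `g ^ dim V = 0`. Their
solution set is a cone, and elimination theory applies
(`exists_mem_ne_zero_imp_forall_eq_zero_of_cone`). Its proof is elementary: by the Nullstellensatz,
if the equations at `F₀` have no nonzero solution, then every monomial of some degree `n` is a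
combination of the left-hand sides at `F₀`. The same combinations of the left-hand sides at `F`
have degree `n` parts whose coefficient matrix is polynomial in `F` and is the identity at `F₀`.
Wherever its determinant is nonzero, all monomials of degree `n` vanish on the solutions, which
are hence zero.
-/

open scoped Topology

/-! ### Elimination theory for cones -/

/-- A polynomial vanishing on the line through `x` has all its homogeneous components vanishing
at `x`: the values of the components are the coefficients of its restriction to that line. -/
theorem MvPolynomial.eval_homogeneousComponent_eq_zero_of_forall_smul {σ : Type*}
    (q : MvPolynomial σ ℂ) (x : σ → ℂ) (h : ∀ t : ℂ, MvPolynomial.eval (t • x) q = 0) (n : ℕ) :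
    MvPolynomial.eval x (MvPolynomial.homogeneousComponent n q) = 0 := by
  classical
  let P : Polynomial ℂ := ∑ i ∈ Finset.range (q.totalDegree + 1),
    Polynomial.monomial i (MvPolynomial.eval x (MvPolynomial.homogeneousComponent i q))
  have hscale : ∀ (t : ℂ) (i : ℕ), MvPolynomial.eval (t • x) (MvPolynomial.homogeneousComponent i q)
      = t ^ i * MvPolynomial.eval x (MvPolynomial.homogeneousComponent i q) := by
    intro t i
    rw [MvPolynomial.eval_eq, MvPolynomial.eval_eq, Finset.mul_sum]
    refine Finset.sum_congr rfl fun m hm => ?_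
    have hdeg : m.degree = i := by
      by_contra hne
      exact MvPolynomial.mem_support_iff.1 hm
        (by rw [MvPolynomial.coeff_homogeneousComponent, if_neg hne])
    simp only [Pi.smul_apply, smul_eq_mul, mul_pow, Finset.prod_mul_distrib,
      Finset.prod_pow_eq_pow_sum]
    rw [← Finsupp.degree_apply, hdeg]
    ring
  have hP : P = 0 := by
    refine Polynomial.funext fun t => ?_
    have ht := h t
    rw [← MvPolynomial.sum_homogeneousComponent q, map_sum] at ht
    simp only [hscale] at ht
    simp only [P, Polynomial.eval_finsetSum, Polynomial.eval_monomial, Polynomial.eval_zero]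
    rw [← ht]
    exact Finset.sum_congr rfl fun i _ => mul_comm _ _
  by_cases hn : n < q.totalDegree + 1
  · have hc : P.coeff n = 0 := by rw [hP, Polynomial.coeff_zero]
    simpa [P, Polynomial.finsetSum_coeff, Polynomial.coeff_monomial, hn] using hc
  · rw [MvPolynomial.homogeneousComponent_eq_zero _ _ (by omega), map_zero]

/-- The projective Nullstellensatz: polynomials without common zero away from the origin generate
an ideal containing all monomials of some positive degree. -/
theorem MvPolynomial.exists_monomial_mem_of_forall_eq_zero {σ ι : Type*} [Finite σ]
    (p : ι → MvPolynomial σ ℂ)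
    (h : ∀ x : σ → ℂ, (∀ i, MvPolynomial.eval x (p i) = 0) → x = 0) :
    ∃ D : ℕ, 0 < D ∧ ∀ m : σ →₀ ℕ, m.degree = D →
      MvPolynomial.monomial m (1 : ℂ) ∈ Ideal.span (Set.range p) := by
  set I := Ideal.span (Set.range p)
  have hrad : MvPolynomial.idealOfVars σ ℂ ≤ I.radical := by
    rw [← MvPolynomial.vanishingIdeal_zeroLocus_eq_radical (K := ℂ), Ideal.span_le]
    rintro _ ⟨j, rfl⟩ x hx
    have hx0 : x = 0 := h x fun i => by
      simpa [MvPolynomial.aeval_eq_eval] using hx (p i) (Ideal.subset_span ⟨i, rfl⟩)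
    simp [hx0]
  obtain ⟨s, hs⟩ := Ideal.exists_pow_le_of_le_radical_of_fg hrad (MvPolynomial.idealOfVars_fg σ ℂ)
  refine ⟨s + 1, s.succ_pos, fun m hm => hs (Ideal.pow_le_pow_right s.le_succ ?_)⟩
  rw [MvPolynomial.pow_idealOfVars_eq_span]
  exact Ideal.subset_span ⟨m, hm, rfl⟩

/-- The main theorem of elimination theory, in terms of points. Let a family of systems of
polynomial equations have coefficients in an algebra `A` of functions of the parameter `w`, and
let each system have a cone as solution set. If the system at `w₀` has only the trivial solution,
then so has the system at every `w` where a certain `D ∈ A` with `D w₀ ≠ 0` does not vanish. -/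
theorem exists_mem_ne_zero_imp_forall_eq_zero_of_cone {W σ ι : Type*} [Finite σ]
    (A : Subalgebra ℂ (W → ℂ)) (p : W → ι → MvPolynomial σ ℂ)
    (hcoeff : ∀ i m, (fun w => (p w i).coeff m) ∈ A)
    (hcone : ∀ w x (t : ℂ), (∀ i, MvPolynomial.eval x (p w i) = 0) →
      ∀ i, MvPolynomial.eval (t • x) (p w i) = 0)
    (w₀ : W) (h₀ : ∀ x : σ → ℂ, (∀ i, MvPolynomial.eval x (p w₀ i) = 0) → x = 0) :
    ∃ D ∈ A, D w₀ ≠ 0 ∧ ∀ w, D w ≠ 0 →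
      ∀ x : σ → ℂ, (∀ i, MvPolynomial.eval x (p w i) = 0) → x = 0 := by
  classical
  have := Fintype.ofFinite σ
  obtain ⟨n, hn, hmon⟩ := MvPolynomial.exists_monomial_mem_of_forall_eq_zero (p w₀) h₀
  simp only [Finsupp.mem_ideal_span_range_iff_exists_finsupp] at hmon
  choose! c hc using hmon
  let T : Finset (σ →₀ ℕ) := Finset.univ.finsuppAntidiag n
  have hT : ∀ m, m ∈ T ↔ m.degree = n := fun m => by
    simp [T, Finset.mem_finsuppAntidiag, Finsupp.degree_eq_sum]
  -- `q m w` keeps the coefficients that express the monomial `m` at `w₀`, but uses the equations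
  -- at `w`, so that `q m w₀` is `m` itself.
  let q : (σ →₀ ℕ) → W → MvPolynomial σ ℂ := fun m w => (c m).sum fun i a => a * p w i
  -- The degree `n` part of `q m w`, in terms of monomials; it is the identity matrix at `w₀`.
  let M : W → Matrix T T ℂ := fun w => Matrix.of fun m m' => (q m w).coeff m'
  refine ⟨fun w => (M w).det, ?_, ?_, ?_⟩
  · have hq : ∀ m m', (fun w => (q m w).coeff m') ∈ A := fun m m' => by
      have : (fun w => (q m w).coeff m') = ∑ i ∈ (c m).support,
          ∑ k ∈ Finset.HasAntidiagonal.antidiagonal m',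
            (c m i).coeff k.1 • fun w => (p w i).coeff k.2 := by
        ext w
        simp [q, Finsupp.sum, MvPolynomial.coeff_sum, MvPolynomial.coeff_mul]
      rw [this]
      exact sum_mem fun i _ => sum_mem fun k _ => A.smul_mem (hcoeff i _) _
    have : (fun w => (M w).det) = ∑ τ : Equiv.Perm T, ((Equiv.Perm.sign τ : ℤ) : ℂ) •
        ∏ m : T, fun w => (q (τ m) w).coeff (m : σ →₀ ℕ) := by
      ext w
      simp [Matrix.det_apply', M]
    rw [this]
    exact sum_mem fun τ _ => A.smul_mem (prod_mem fun m _ => hq _ _) _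
  · have : M w₀ = 1 := by
      ext m m'
      have hm : q m w₀ = MvPolynomial.monomial m.1 1 := hc m ((hT _).1 m.2)
      simp only [M, Matrix.of_apply, hm, MvPolynomial.coeff_monomial, Matrix.one_apply,
        Subtype.ext_iff]
    simp [this]
  -- A common zero at `w` is a zero of the degree `n` part of every `q m w`, so its vector of
  -- degree `n` monomials lies in the kernel of `M w`.
  · intro w hw x hx
    have hker : (M w).mulVec (fun m' => m'.1.prod fun j e => x j ^ e) = 0 := by
      ext m
      have h := MvPolynomial.eval_homogeneousComponent_eq_zero_of_forall_smul (q m w) x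
        (fun t => by simp [q, Finsupp.sum, hcone w x t hx]) n
      have hsum : MvPolynomial.homogeneousComponent n (q m w) =
          ∑ m' ∈ T, MvPolynomial.monomial m' ((q m w).coeff m') := by
        ext k
        simp [MvPolynomial.coeff_homogeneousComponent, MvPolynomial.coeff_sum,
          MvPolynomial.coeff_monomial, hT]
      rw [hsum, map_sum, ← Finset.sum_coe_sort] at h
      simpa [Matrix.mulVec, dotProduct, M, MvPolynomial.eval_monomial] using h
    have hzero := Matrix.eq_zero_of_mulVec_eq_zero hw hker
    ext j
    have hj := congr_fun hzero ⟨Finsupp.single j n, (hT _).2 (by simp)⟩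
    simpa [hn.ne'] using hj

/-! ### Zariski open sets and linear algebra -/

theorem isOpen_setOf_polyFunction_ne_zero {W : Type*} [AddCommGroup W] [Module ℂ W] {f : W → ℂ}
    (hf : f ∈ polyFunctions W) : IsOpen[zariskiTopology W] {w | f w ≠ 0} := by
  change ∃ S : Set (W → ℂ), S ⊆ (polyFunctions W : Set (W → ℂ)) ∧
    {w | f w ≠ 0}ᶜ = {w | ∀ f ∈ S, f w = 0}
  exact ⟨{f}, by simpa using hf, by ext w; simp⟩

theorem IsNilpotent.pow_finrank_eq_zero {K V : Type*} [Field K] [AddCommGroup V] [Module K V]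
    [FiniteDimensional K V] {g : Module.End K V} (hg : IsNilpotent g) :
    g ^ Module.finrank K V = 0 := by
  simpa [hg.charpoly_eq_X_pow_finrank] using g.aeval_self_charpoly

/-- A linear map to `K ^ dim S`, defined on the whole space, that is injective on `S`. -/
theorem Submodule.exists_linearMap_injOn {K E : Type*} [Field K] [AddCommGroup E] [Module K E]
    (S : Submodule K E) [FiniteDimensional K S] :
    ∃ φ : E →ₗ[K] (Fin (Module.finrank K S) → K), ∀ x ∈ S, φ x = 0 → x = 0 := by
  obtain ⟨φ, hφ⟩ := (Module.finBasis K S).equivFun.toLinearMap.exists_extend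
  refine ⟨φ, fun x hx h => ?_⟩
  have h' : (Module.finBasis K S).equivFun ⟨x, hx⟩ = 0 := by
    rw [← h]; exact (LinearMap.congr_fun hφ ⟨x, hx⟩).symm
  simpa using h'

theorem const_mem_subalgebra {W : Type*} (A : Subalgebra ℂ (W → ℂ)) (a : ℂ) :
    (fun _ => a) ∈ A :=
  A.algebraMap_mem a

/-! ### The equations of nilpotent symmetrizers -/

/-- The linear form `g ↦ F(v_1, …, g v_i, …, v_d) - F(v_1, …, g v_j, …, v_d)` on `End V`. -/
noncomputable def symmetrizerDefect {V : Type*} [AddCommGroup V] [Module ℂ V] {d : ℕ}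
    (F : SymForm V d) (i j : Fin d) (v : Fin d → V) : Module.End ℂ V →ₗ[ℂ] ℂ :=
  (F.1.toLinearMap v i).comp (LinearMap.applyₗ (v i)) -
    (F.1.toLinearMap v j).comp (LinearMap.applyₗ (v j))

theorem symmetrizerDefect_apply {V : Type*} [AddCommGroup V] [Module ℂ V] {d : ℕ}
    (F : SymForm V d) (i j : Fin d) (v : Fin d → V) (g : Module.End ℂ V) :
    symmetrizerDefect F i j v g =
      F.1 (Function.update v i (g (v i))) - F.1 (Function.update v j (g (v j))) := rfl

theorem mem_symmetrizerAlgebra_iff_symmetrizerDefect {V : Type*} [AddCommGroup V] [Module ℂ V]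
    {d : ℕ} (F : SymForm V d) (g : Module.End ℂ V) :
    g ∈ symmetrizerAlgebra F ↔ ∀ i j v, symmetrizerDefect F i j v g = 0 := by
  simp only [symmetrizerDefect_apply, sub_eq_zero]
  rfl

theorem symForm_apply_mem_polyFunctions {V : Type*} [AddCommGroup V] [Module ℂ V] {d : ℕ}
    (v : Fin d → V) : (fun F : SymForm V d => F.1 v) ∈ polyFunctions (SymForm V d) :=
  Algebra.subset_adjoin
    ⟨{ toFun := fun F => F.1 v, map_add' := fun _ _ => rfl, map_smul' := fun _ _ => rfl }, rfl⟩

theorem symmetrizerDefect_mem_polyFunctions {V : Type*} [AddCommGroup V] [Module ℂ V] {d : ℕ}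
    (i j : Fin d) (v : Fin d → V) (g : Module.End ℂ V) :
    (fun F : SymForm V d => symmetrizerDefect F i j v g) ∈ polyFunctions (SymForm V d) :=
  sub_mem (symForm_apply_mem_polyFunctions _) (symForm_apply_mem_polyFunctions _)

/-- The linear form `∑ a_k X_k` as a polynomial. -/
noncomputable def MvPolynomial.linearForm {σ : Type*} [Fintype σ] (a : σ → ℂ) : MvPolynomial σ ℂ :=
  ∑ k, MvPolynomial.C (a k) * MvPolynomial.X k

theorem MvPolynomial.eval_linearForm {σ E : Type*} [Fintype σ] [DecidableEq σ] [AddCommGroup E]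
    [Module ℂ E] (e : (σ → ℂ) →ₗ[ℂ] E) (l : E →ₗ[ℂ] ℂ) (x : σ → ℂ) :
    MvPolynomial.eval x (MvPolynomial.linearForm fun k => l (e (Pi.single k 1))) = l (e x) := by
  have h := LinearMap.pi_apply_eq_sum_univ (l ∘ₗ e) x
  simp only [LinearMap.comp_apply] at h
  rw [h]
  simp only [MvPolynomial.linearForm, map_sum, map_mul, MvPolynomial.eval_C, MvPolynomial.eval_X,
    smul_eq_mul]
  refine Finset.sum_congr rfl fun k _ => ?_
  rw [mul_comm]
  congr 4
  ext i
  simp [Pi.single_apply, eq_comm]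

theorem MvPolynomial.coeff_linearForm_mem {W σ : Type*} [Fintype σ]
    (A : Subalgebra ℂ (W → ℂ)) (a : W → σ → ℂ) (ha : ∀ k, (fun w => a w k) ∈ A) (m : σ →₀ ℕ) :
    (fun w => (MvPolynomial.linearForm (a w)).coeff m) ∈ A := by
  have : (fun w => (MvPolynomial.linearForm (a w)).coeff m) =
      ∑ k, (MvPolynomial.X k : MvPolynomial σ ℂ).coeff m • fun w => a w k := by
    ext w
    simp only [MvPolynomial.linearForm, MvPolynomial.coeff_sum, MvPolynomial.coeff_C_mul,
      Finset.sum_apply, Pi.smul_apply, smul_eq_mul]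
    exact Finset.sum_congr rfl fun k _ => mul_comm _ _
  rw [this]
  exact sum_mem fun k _ => A.smul_mem (ha k) _

theorem Matrix.isNilpotent_of_curry_iff {n : ℕ} (x : Fin n × Fin n → ℂ) :
    IsNilpotent (Matrix.of (Function.curry x)) ↔
      ∀ i j, MvPolynomial.eval x ((Matrix.mvPolynomialX (Fin n) (Fin n) ℂ ^ n) i j) = 0 := by
  have hx : (MvPolynomial.eval x).mapMatrix (Matrix.mvPolynomialX (Fin n) (Fin n) ℂ) =
      Matrix.of (Function.curry x) := by
    ext i j
    simp [Function.curry]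
  have hpow : ∀ i j, MvPolynomial.eval x ((Matrix.mvPolynomialX (Fin n) (Fin n) ℂ ^ n) i j) =
      (Matrix.of (Function.curry x) ^ n) i j := by
    intro i j
    rw [← hx, ← map_pow, RingHom.mapMatrix_apply, Matrix.map_apply]
  simp only [hpow]
  refine ⟨fun h i j => ?_, fun h => ⟨n, Matrix.ext h⟩⟩
  have h1 := IsNilpotent.pow_finrank_eq_zero (h.map Matrix.toLinAlgEquiv')
  rw [Module.finrank_fin_fun, ← map_pow,
    map_eq_zero_iff _ Matrix.toLinAlgEquiv'.injective] at h1
  rw [h1, Matrix.zero_apply]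

/-- In suitable linear coordinates on `End V`, the nilpotent endomorphisms are the common zeros of
finitely many polynomials, namely of the entries of a power of the generic matrix. -/
theorem exists_mvPolynomial_eval_eq_zero_iff_isNilpotent (V : Type*) [AddCommGroup V] [Module ℂ V]
    [FiniteDimensional ℂ V] :
    ∃ (n : ℕ) (e : (Fin n × Fin n → ℂ) ≃ₗ[ℂ] Module.End ℂ V)
      (r : Fin n × Fin n → MvPolynomial (Fin n × Fin n) ℂ),
      ∀ x, (∀ k, MvPolynomial.eval x (r k) = 0) ↔ IsNilpotent (e x) := by
  let b := Module.finBasis ℂ V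
  refine ⟨Module.finrank ℂ V, (LinearEquiv.curry ℂ ℂ _ _).trans (Matrix.toLin b b),
    fun k => (Matrix.mvPolynomialX _ _ ℂ ^ Module.finrank ℂ V) k.1 k.2, fun x => ?_⟩
  change _ ↔ IsNilpotent (Matrix.toLinAlgEquiv b (Matrix.of (Function.curry x)))
  rw [IsNilpotent.map_iff (Matrix.toLinAlgEquiv b).injective, Matrix.isNilpotent_of_curry_iff,
    Prod.forall]

/-- Elimination for nilpotent symmetrizers: having no nonzero nilpotent symmetrizer in the kernel
of `φ` is a Zariski open condition on the form. -/
theorem exists_polyFunction_ne_zero_imp_nilpotent_symmetrizer_eq_zero {V : Type*} [AddCommGroup V]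
    [Module ℂ V] [FiniteDimensional ℂ V] {d c : ℕ} (φ : Module.End ℂ V →ₗ[ℂ] (Fin c → ℂ))
    (F₀ : SymForm V d)
    (h₀ : ∀ g ∈ symmetrizerAlgebra F₀, IsNilpotent g → φ g = 0 → g = 0) :
    ∃ D ∈ polyFunctions (SymForm V d), D F₀ ≠ 0 ∧ ∀ F, D F ≠ 0 →
      ∀ g ∈ symmetrizerAlgebra F, IsNilpotent g → φ g = 0 → g = 0 := by
  obtain ⟨n, e, r, hr⟩ := exists_mvPolynomial_eval_eq_zero_iff_isNilpotent V
  -- The equations in the matrix entries of `g`: being a symmetrizer, `φ g = 0`, and nilpotency.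
  let p : SymForm V d → (Fin d × Fin d × (Fin d → V)) ⊕ Fin c ⊕ (Fin n × Fin n) →
      MvPolynomial (Fin n × Fin n) ℂ :=
    fun F => Sum.elim
      (fun t => MvPolynomial.linearForm fun k =>
        symmetrizerDefect F t.1 t.2.1 t.2.2 (e (Pi.single k 1)))
      (Sum.elim
        (fun l => MvPolynomial.linearForm fun k => (LinearMap.proj l ∘ₗ φ) (e (Pi.single k 1)))
        r)
  have hp : ∀ F x, (∀ t, MvPolynomial.eval x (p F t) = 0) ↔
      e x ∈ symmetrizerAlgebra F ∧ φ (e x) = 0 ∧ IsNilpotent (e x) := by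
    intro F x
    rw [Sum.forall, Sum.forall, mem_symmetrizerAlgebra_iff_symmetrizerDefect, ← hr, funext_iff]
    simp only [p, Sum.elim_inl, Sum.elim_inr]
    refine and_congr ?_ (and_congr ?_ Iff.rfl)
    · have h := fun t : Fin d × Fin d × (Fin d → V) =>
        MvPolynomial.eval_linearForm e.toLinearMap (symmetrizerDefect F t.1 t.2.1 t.2.2) x
      simp only [LinearEquiv.coe_coe] at h
      simp only [h, Prod.forall]
    · have h := fun l => MvPolynomial.eval_linearForm e.toLinearMap (LinearMap.proj l ∘ₗ φ) x
      simp only [LinearEquiv.coe_coe] at h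
      simp only [h]
      rfl
  have hcoeff : ∀ t m, (fun F => (p F t).coeff m) ∈ polyFunctions (SymForm V d) := by
    rintro (t | l | k) m
    · exact MvPolynomial.coeff_linearForm_mem _ _
        (fun k => symmetrizerDefect_mem_polyFunctions _ _ _ _) m
    -- The remaining equations do not depend on `F`, so their coefficients are constant.
    · exact const_mem_subalgebra _ (MvPolynomial.coeff m
        (MvPolynomial.linearForm fun k => (LinearMap.proj l ∘ₗ φ) (e (Pi.single k 1))))
    · exact const_mem_subalgebra _ (MvPolynomial.coeff m (r k))
  have hcone : ∀ F x (t : ℂ), (∀ i, MvPolynomial.eval x (p F i) = 0) →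
      ∀ i, MvPolynomial.eval (t • x) (p F i) = 0 := by
    intro F x t hx
    rw [hp] at hx ⊢
    rw [map_smul, map_smul, hx.2.1, smul_zero]
    exact ⟨Submodule.smul_mem _ t hx.1, rfl, hx.2.2.smul t⟩
  obtain ⟨D, hD, hD₀, hDF⟩ := exists_mem_ne_zero_imp_forall_eq_zero_of_cone
    (polyFunctions (SymForm V d)) p hcoeff hcone F₀ fun x hx => by
      rw [hp] at hx
      simpa using h₀ _ hx.1 hx.2.2 hx.2.1
  refine ⟨D, hD, hD₀, fun F hF g hg hgn hφ => ?_⟩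
  have := hDF F hF (e.symm g) ((hp F _).2 (by simpa using ⟨hg, hφ, hgn⟩))
  simpa using this

theorem mainTheorem12 {V : Type*} [AddCommGroup V] [Module ℂ V] [FiniteDimensional ℂ V]
    (hN : 3 ≤ Module.finrank ℂ V) {d : ℕ} (hd : 3 ≤ d) :
    UpperSemicontinuous
      (fun F : SymFormNotCone V d => (Module.finrank ℂ (nilpotentPart hd F) : ℤ)) := by
  intro F₀ y hy
  obtain ⟨φ, hφ⟩ := (nilpotentPart hd F₀).exists_linearMap_injOn
  obtain ⟨D, hD, hD₀, hDF⟩ := exists_polyFunction_ne_zero_imp_nilpotent_symmetrizer_eq_zero φ F₀.1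
    fun g hg hgn => hφ g ⟨hg, hgn⟩
  have hopen : IsOpen {F : SymFormNotCone V d | D F.1 ≠ 0} :=
    ⟨_, isOpen_setOf_polyFunction_ne_zero hD, rfl⟩
  refine Filter.eventually_of_mem (hopen.mem_nhds hD₀) fun F hF => lt_of_le_of_lt ?_ hy
  have hinj : Function.Injective (φ.domRestrict (nilpotentPart hd F)) := by
    rw [injective_iff_map_eq_zero]
    exact fun g hg => Subtype.ext (hDF F.1 hF g.1 g.2.1 g.2.2 hg)
  simpa using LinearMap.finrank_le_finrank_of_injective hinj
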